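/- **Setting.** Let $N,K_1,K_2^*\in\mathbb N$ and $n_{\mathrm{in}},n_{\mathrm{eq}}\in\mathbb Z_+$. For $i=1,\dots,N$ let $\mathcal X_i\subset\mathbb R$ be non-empty and compact and let $\mu_i$ be a Borel probability measure on $\mathcal X_i$; put $\boldsymbol{\mathcal X}=\mathcal X_1\times\cdots\times\mathcal X_N$. Let $c_1\in\mathbb R^{K_1}$, $L_{\mathrm{in}}\in\mathbb R^{n_{\mathrm{in}}\times K_1}$, $q_{\mathrm{in}}\in\mathbb R^{n_{\mathrm{in}}}$, $L_{\mathrm{eq}}\in\mathbb R^{n_{\mathrm{eq}}\times K_1}$, $q_{\mathrm{eq}}\in\mathbb R^{n_{\mathrm{eq}}}$ be such that $S_1=\{a\in\mathbb R^{K_1}: L_{\mathrm{in}}a\le q_{\mathrm{in}},\ L_{\mathrm{eq}}a=q_{\mathrm{eq}}\}$ is non-empty. Let $V\in\mathbb R^{K_2^*\times K_1}$, $W\in\mathbb R^{K_2^*\times N}$, $b\in\mathbb R^{K_2^*}$, and let $S_2^*\subset\mathbb R^{K_2^*}$ be a non-empty polytope (bounded polyhedron). Put $Q(a,x)=\max_{\lambda\in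 S_2^*}\langle Va+Wx+b,\lambda\rangle$. Let $\Gamma(\mu_1,\dots,\mu_N)$ be the set of Borel probability measures on $\boldsymbol{\mathcal X}$ with marginals $\mu_1,\dots,\mu_N$, and let $$\phi_{\mathrm{DRO}}=\inf_{a\in S_1}\Big\{\langle c_1,a\rangle+\sup_{\mu\in\Gamma(\mu_1,\dots,\mu_N)}\int_{\boldsymbol{\mathcal X}} Q(a,x)\,\mu(dx)\Big\}.$$ For each $i$ let $\mathcal G_i=\{g_{i,1},\dots,g_{i,m_i}\}$ be a finite collection of continuous functions $\mathcal X_i\to\mathbb R$, and let $[\mu_i]_{\mathcal G_i}$ be the set of Borel probability measures $\nu$ on $\mathcal X_i$ with $\int g_{i,j}\,d\nu=\int g_{i,j}\,d\mu_i$ for all $j$. Let $\Gamma_{\mathrm{aug}}$ be the set of Borel probability measures on $\boldsymbol{\mathcal X}\times S_2^*$ whose marginal on $\mathcal X_i$ lies in $[\mu_i]_{\mathcal G_i}$ for every $i$, and let $$\phi_{\mathrm{DRO\text{-}sur}}=\inf_{a\in S_1}\Big\{\langle c_1,a\rangle+\sup_{\gamma\in\Gamma_{\mathrm{aug}}}\int_{\boldsymbol{\mathcal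 X}\times S_2^*}\langle Va+Wx+b,\lambda\rangle\,\gamma(dx,d\lambda)\Big\}.$$ Let $m=\sum_i m_i$, $g(x)=(g_{i,j}(x_i))_{i,j}\in\mathbb R^m$ for $x\in\boldsymbol{\mathcal X}$, and $v=(\int g_{i,j}\,d\mu_i)_{i,j}\in\mathbb R^m$. Consider the linear semi-infinite program $$(\mathsf{LSIP})\quad \inf\big\{\langle c_1,a\rangle+y_0+\langle v,y\rangle\big\}$$ over $a\in\mathbb R^{K_1}$, $y_0\in\mathbb R$, $y\in\mathbb R^m$ subject to $y_0+\langle g(x),y\rangle-\langle V^{\mathsf T}\lambda,a\rangle\ge\langle Wx+b,\lambda\rangle$ for all $x\in\boldsymbol{\mathcal X}$, $\lambda\in S_2^*$, and $L_{\mathrm{in}}a\le q_{\mathrm{in}}$, $L_{\mathrm{eq}}a=q_{\mathrm{eq}}$; and its dual $$(\mathsf{LSIP}^*)\quad \sup\Big\{\langle q_{\mathrm{in}},\xi_{\mathrm{in}}\rangle+\langle q_{\mathrm{eq}},\xi_{\mathrm{eq}}\rangle+\int_{\boldsymbol{\mathcal X}\times S_2^*}\langle Wx+b,\lambda\rangle\,\gamma(dx,d\lambda)\Big\}$$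 over $\xi_{\mathrm{in}}\in\mathbb R^{n_{\mathrm{in}}}$ with $\xi_{\mathrm{in}}\le 0$, $\xi_{\mathrm{eq}}\in\mathbb R^{n_{\mathrm{eq}}}$ and $\gamma\in\Gamma_{\mathrm{aug}}$ subject to $L_{\mathrm{in}}^{\mathsf T}\xi_{\mathrm{in}}+L_{\mathrm{eq}}^{\mathsf T}\xi_{\mathrm{eq}}-V^{\mathsf T}\int\lambda\,\gamma(dx,d\lambda)=c_1$. All optimal values are taken in $[-\infty,\infty]$, with $\sup\emptyset=-\infty$. **Theorem.** (i) The optimal value of $(\mathsf{LSIP})$ equals $\phi_{\mathrm{DRO\text{-}sur}}$. (ii) Strong duality holds between $(\mathsf{LSIP})$ and $(\mathsf{LSIP}^*)$: their optimal values are equal. In particular, the optimal value of $(\mathsf{LSIP})$ is at least $\phi_{\mathrm{DRO}}$. -/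

import Mathlib

open MeasureTheory Matrix

/-- A polyhedron in `ℝ^n`: an intersection of finitely many closed half-spaces. -/
def IsPolyhedron {n : ℕ} (S : Set (Fin n → ℝ)) : Prop :=
  ∃ (r : ℕ) (A : Matrix (Fin r) (Fin n) ℝ) (d : Fin r → ℝ), S = {z | A *ᵥ z ≤ d}

/-- A polytope in `ℝ^n`: a bounded polyhedron. -/
def IsPolytope {n : ℕ} (S : Set (Fin n → ℝ)) : Prop :=
  IsPolyhedron S ∧ Bornology.IsBounded S

/-- The set `Γ(ν₁, …, ν_N)` of couplings of the probability measures `ν i` on `X i`. -/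
def couplings {N : ℕ} {X : Fin N → Set ℝ} (ν : ∀ i, ProbabilityMeasure (X i)) :
    Set (ProbabilityMeasure (∀ i, X i)) :=
  {γ | ∀ i, (γ : Measure (∀ i, X i)).map (fun x => x i) = (ν i : Measure (X i))}

/-- The set `Γ_aug(ν₁, …, ν_N)` of probability measures on `(X₁ × ⋯ × X_N) × S` whose marginal
on `X i` is `ν i` for every `i`, the marginal on `S` being unconstrained. -/
def augCouplings {N K : ℕ} {X : Fin N → Set ℝ} (S : Set (Fin K → ℝ))
    (ν : ∀ i, ProbabilityMeasure (X i)) : Set (ProbabilityMeasure ((∀ i, X i) × S)) :=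
  {γ | ∀ i, (γ : Measure ((∀ i, X i) × S)).map (fun p => p.1 i) = (ν i : Measure (X i))}

/-- `𝒫(X; G)`: the probability measures on `X` that integrate every function in `G`. -/
def integratingMeasures {X : Set ℝ} (G : Set (X → ℝ)) : Set (ProbabilityMeasure X) :=
  {ν | ∀ g ∈ G, Integrable g (ν : Measure X)}

/-- The moment set `[μ]_G` centered at `μ`: the probability measures on `X` that integrate
every function in `G` and give it the same integral as `μ`. -/
def momentSet {X : Set ℝ} (G : Set (X → ℝ)) (μ : ProbabilityMeasure X) :
    Set (ProbabilityMeasure X) :=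
  {ν | ν ∈ integratingMeasures G ∧
    ∀ g ∈ G, ∫ x, g x ∂(ν : Measure X) = ∫ x, g x ∂(μ : Measure X)}

/-- The relaxed ambiguity set `Γ_aug([μ₁]_{G₁}, …, [μ_N]_{G_N})`. -/
def augMomentCouplings {N K : ℕ} {X : Fin N → Set ℝ} (S : Set (Fin K → ℝ))
    (G : ∀ i, Set (X i → ℝ)) (μ : ∀ i, ProbabilityMeasure (X i)) :
    Set (ProbabilityMeasure ((∀ i, X i) × S)) :=
  {γ | ∃ ν : ∀ i, ProbabilityMeasure (X i),
    (∀ i, ν i ∈ momentSet (G i) (μ i)) ∧ γ ∈ augCouplings S ν}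

/-- The data of a two-stage distributionally robust optimization problem with marginal
constraints: `N` uncertain quantities, first-stage decisions in `ℝ^K₁` subject to `nin` linear
inequalities and `neq` linear equalities, and a second-stage cost given in dual form as a maximum
over a non-empty polytope in `ℝ^K₂`. -/
structure DROProblem (N K₁ K₂ nin neq : ℕ) where
  /-- the supports of the uncertain quantities -/
  X : Fin N → Set ℝ
  X_nonempty : ∀ i, (X i).Nonempty
  X_compact : ∀ i, IsCompact (X i)
  /-- the marginal distributions -/
  μ : ∀ i, ProbabilityMeasure (X i)
  c₁ : Fin K₁ → ℝ
  Lin : Matrix (Fin nin) (Fin K₁) ℝ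
  qin : Fin nin → ℝ
  Leq : Matrix (Fin neq) (Fin K₁) ℝ
  qeq : Fin neq → ℝ
  feasible : ∃ a : Fin K₁ → ℝ, Lin *ᵥ a ≤ qin ∧ Leq *ᵥ a = qeq
  V : Matrix (Fin K₂) (Fin K₁) ℝ
  W : Matrix (Fin K₂) (Fin N) ℝ
  b : Fin K₂ → ℝ
  /-- the dual feasible set of the second stage -/
  S₂ : Set (Fin K₂ → ℝ)
  S₂_nonempty : S₂.Nonempty
  S₂_polytope : IsPolytope S₂

namespace DROProblem

variable {N K₁ K₂ nin neq : ℕ} (P : DROProblem N K₁ K₂ nin neq)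

/-- The first-stage feasible set. -/
def S₁ : Set (Fin K₁ → ℝ) := {a | P.Lin *ᵥ a ≤ P.qin ∧ P.Leq *ᵥ a = P.qeq}

/-- A point of `X₁ × ⋯ × X_N` as a vector of `ℝ^N`. -/
def vec (x : ∀ i, P.X i) : Fin N → ℝ := fun i => (x i : ℝ)

/-- `Q_aug(a, x, l) = ⟨V a + W x + b, l⟩`. -/
def Qaug (a : Fin K₁ → ℝ) (x : ∀ i, P.X i) (l : P.S₂) : ℝ :=
  (P.V *ᵥ a + P.W *ᵥ P.vec x + P.b) ⬝ᵥ (l : Fin K₂ → ℝ)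

/-- The second-stage cost `Q(a, x) = max_{l ∈ S₂} ⟨V a + W x + b, l⟩`. -/
noncomputable def Q (a : Fin K₁ → ℝ) (x : ∀ i, P.X i) : ℝ := ⨆ l : P.S₂, P.Qaug a x l

/-- The supremum in the definition of `Q` is a maximum. -/
theorem isGreatest_Q (a : Fin K₁ → ℝ) (x : ∀ i, P.X i) :
    IsGreatest (Set.range (P.Qaug a x)) (P.Q a x) := by
  obtain ⟨⟨r, A, d, hS⟩, hb⟩ := P.S₂_polytope
  have hc : IsClosed P.S₂ := by
    rw [hS]
    exact isClosed_le (by fun_prop) continuous_const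
  have hk : CompactSpace P.S₂ :=
    isCompact_iff_compactSpace.mp (Metric.isCompact_of_isClosed_isBounded hc hb)
  have hn : Nonempty P.S₂ := P.S₂_nonempty.to_subtype
  have hf : Continuous (P.Qaug a x) := by
    unfold Qaug
    exact continuous_const.dotProduct continuous_subtype_val
  exact (isCompact_range hf).isGreatest_sSup (Set.range_nonempty _)

/-- The worst-case expected cost `φ(a)` over all couplings of the marginals. -/
noncomputable def φ (a : Fin K₁ → ℝ) : EReal :=
  ((P.c₁ ⬝ᵥ a : ℝ) : EReal) +
    ⨆ γ ∈ couplings P.μ, ((∫ x, P.Q a x ∂(γ : Measure (∀ i, P.X i)) : ℝ) : EReal)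

/-- `φ_DRO`, the optimal value of the two-stage problem. -/
noncomputable def φDRO : EReal := ⨅ a ∈ P.S₁, P.φ a

/-- The surrogate function `φ_sur(a)` for the families `G i` of moment functions. -/
noncomputable def φsur (G : ∀ i, Set (P.X i → ℝ)) (a : Fin K₁ → ℝ) : EReal :=
  ((P.c₁ ⬝ᵥ a : ℝ) : EReal) +
    ⨆ γ ∈ augMomentCouplings P.S₂ G P.μ,
      ((∫ p, P.Qaug a p.1 p.2 ∂(γ : Measure ((∀ i, P.X i) × P.S₂)) : ℝ) : EReal)

/-- `φ_DRO-sur`, the optimal value of the relaxed problem. -/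
noncomputable def φDROsur (G : ∀ i, Set (P.X i → ℝ)) : EReal := ⨅ a ∈ P.S₁, P.φsur G a

variable {m : Fin N → ℕ} (g : ∀ i, Fin (m i) → P.X i → ℝ)

/-- The stacked vector `g(x) = (g_{i,j}(x_i))_{i,j}`. -/
def gvec (x : ∀ i, P.X i) : ((i : Fin N) × Fin (m i)) → ℝ := fun k => g k.1 k.2 (x k.1)

/-- The stacked vector `v = (∫ g_{i,j} dμ_i)_{i,j}` of moments. -/
noncomputable def vvec : ((i : Fin N) × Fin (m i)) → ℝ :=
  fun k => ∫ x, g k.1 k.2 x ∂(P.μ k.1 : Measure (P.X k.1))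

/-- The feasible points `(a, y₀, y)` of the linear semi-infinite program. -/
def lsipFeasible : Set ((Fin K₁ → ℝ) × ℝ × (((i : Fin N) × Fin (m i)) → ℝ)) :=
  {t | (∀ (x : ∀ i, P.X i) (l : P.S₂),
          t.2.1 + P.gvec g x ⬝ᵥ t.2.2 - (P.Vᵀ *ᵥ (l : Fin K₂ → ℝ)) ⬝ᵥ t.1
            ≥ (P.W *ᵥ P.vec x + P.b) ⬝ᵥ (l : Fin K₂ → ℝ)) ∧
        P.Lin *ᵥ t.1 ≤ P.qin ∧ P.Leq *ᵥ t.1 = P.qeq}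

/-- The optimal value of the linear semi-infinite program (LSIP). -/
noncomputable def lsipValue : EReal :=
  ⨅ t ∈ P.lsipFeasible g, ((P.c₁ ⬝ᵥ t.1 + t.2.1 + P.vvec g ⬝ᵥ t.2.2 : ℝ) : EReal)

/-- The feasible points `(ξ_in, ξ_eq, γ)` of the dual program. -/
def dualFeasible :
    Set ((Fin nin → ℝ) × (Fin neq → ℝ) × ProbabilityMeasure ((∀ i, P.X i) × P.S₂)) :=
  {t | t.1 ≤ 0 ∧
       t.2.2 ∈ augMomentCouplings P.S₂ (fun i => Set.range (g i)) P.μ ∧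
       P.Linᵀ *ᵥ t.1 + P.Leqᵀ *ᵥ t.2.1
         - P.Vᵀ *ᵥ (fun k => ∫ p, (p.2 : Fin K₂ → ℝ) k
              ∂(t.2.2 : Measure ((∀ i, P.X i) × P.S₂))) = P.c₁}

/-- The optimal value of the dual program (LSIP*). -/
noncomputable def dualValue : EReal :=
  ⨆ t ∈ P.dualFeasible g,
    ((P.qin ⬝ᵥ t.1 + P.qeq ⬝ᵥ t.2.1
      + ∫ p, (P.W *ᵥ P.vec p.1 + P.b) ⬝ᵥ (p.2 : Fin K₂ → ℝ)
          ∂(t.2.2 : Measure ((∀ i, P.X i) × P.S₂)) : ℝ) : EReal)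

end DROProblem

/-! The chain dual ≤ surrogate ≤ LSIP is weak duality: pair the dual constraint with a feasible `a`,
or integrate the semi-infinite constraint against a coupling. The substance is the reverse
direction, `lsipValue_le_of_forall_exists_lt`: if every relaxed coupling can be answered by some `a`
in a convex set `A ⊆ S₁` with cost below `α`, then LSIP has value at most `α`. The set `A` is a
single point for the surrogate and all of `S₁` for the dual.

That lemma is a minimax statement over all probability measures on the compact space `X × S₂`. The
moment equations go into the Lagrangian with the free multiplier `y`, which drives the integral down
at any measure violating them. Exchanging the quantifiers
(`exists_forall_lt_of_forall_exists_integral_lt`) rests on weak compactness and finite-dimensional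
separation. For the dual, minimising over `a` with the coupling fixed is a finite linear program,
and its multipliers come from Farkas' lemma. -/

/-! ### Finite-dimensional linear programming duality. -/

/-- **Farkas' lemma** for finitely many linear functionals on a real vector space. -/
theorem exists_nonneg_sum_smul_eq_of_forall_nonpos {ι W : Type*} [AddCommGroup W] [Module ℝ W]
    (s : Finset ι) (A : ι → W →ₗ[ℝ] ℝ) (γ : W →ₗ[ℝ] ℝ)
    (h : ∀ x, (∀ i ∈ s, A i x ≤ 0) → γ x ≤ 0) :
    ∃ w : ι → ℝ, (∀ i ∈ s, 0 ≤ w i) ∧ ∀ x, γ x = ∑ i ∈ s, w i * A i x := by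
  classical
  induction s using Finset.induction_on generalizing A γ with
  | empty =>
    refine ⟨0, by simp, fun x => ?_⟩
    have h1 := h x (by simp)
    have h2 := h (-x) (by simp)
    simp only [map_neg] at h2
    simp only [Finset.sum_empty]
    linarith
  | insert j s hj ih =>
    by_cases hs : ∀ x, (∀ i ∈ s, A i x ≤ 0) → γ x ≤ 0
    · obtain ⟨w, hw, hγ⟩ := ih A γ hs
      refine ⟨Function.update w j 0, fun i hi => ?_, fun x => ?_⟩
      · by_cases hij : i = j
        · simp [hij]
        · simpa [hij] using hw i ((Finset.mem_insert.1 hi).resolve_left hij)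
      · rw [Finset.sum_insert hj, hγ x]
        simp only [Function.update_self, zero_mul, zero_add]
        exact Finset.sum_congr rfl fun i hi => by
          rw [Function.update_of_ne (ne_of_mem_of_not_mem hi hj)]
    · push Not at hs
      obtain ⟨u, hu, hγu⟩ := hs
      have hju : 0 < A j u := by
        by_contra! hc
        refine absurd (h u fun i hi => ?_) (not_le.2 hγu)
        rcases Finset.mem_insert.1 hi with rfl | hi
        exacts [hc, hu i hi]
      set t := (A j u)⁻¹ with ht
      have ht0 : 0 < t := inv_pos.2 hju
      have htu : t * A j u = 1 := inv_mul_cancel₀ hju.ne'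
      -- Project along `u` onto the kernel of `A j`. Composed with this projection, the functionals
      -- still satisfy the implication, now without the constraint `j`.
      obtain ⟨w, hw, hγ⟩ := ih (fun i => A i - (t * A i u) • A j) (γ - (t * γ u) • A j) (by
        intro x hx
        have := h (x - (t * A j x) • u) (fun i hi => by
          rcases Finset.mem_insert.1 hi with rfl | hi
          · simp only [map_sub, map_smul, smul_eq_mul]
            linear_combination (norm := skip) (-A i x) * htu
            apply le_of_eq; ring
          · have := hx i hi
            simp only [LinearMap.sub_apply, LinearMap.smul_apply, smul_eq_mul] at this
            simp only [map_sub, map_smul, smul_eq_mul]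
            linarith)
        simp only [map_sub, map_smul, smul_eq_mul] at this
        simp only [LinearMap.sub_apply, LinearMap.smul_apply, smul_eq_mul]
        linarith)
      -- The new weight collects the coefficients of `A j`; it is nonnegative because `γ u > 0` and
      -- `A i u ≤ 0` on `s`.
      refine ⟨Function.update w j (t * γ u - ∑ i ∈ s, w i * (t * A i u)), fun i hi => ?_,
        fun x => ?_⟩
      · by_cases hij : i = j
        · subst hij
          have : ∑ k ∈ s, w k * (t * A k u) ≤ 0 := Finset.sum_nonpos fun k hk =>
            mul_nonpos_of_nonneg_of_nonpos (hw k hk)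
              (mul_nonpos_of_nonneg_of_nonpos ht0.le (hu k hk))
          have : 0 ≤ t * γ u := (mul_pos ht0 hγu).le
          simp only [Function.update_self]
          linarith
        · simpa [hij] using hw i ((Finset.mem_insert.1 hi).resolve_left hij)
      · have h1 : ∑ i ∈ s, Function.update w j (t * γ u - ∑ i ∈ s, w i * (t * A i u)) i * A i x
            = ∑ i ∈ s, w i * A i x := Finset.sum_congr rfl fun i hi => by
          rw [Function.update_of_ne (ne_of_mem_of_not_mem hi hj)]
        have h2 := hγ x
        simp only [LinearMap.sub_apply, LinearMap.smul_apply, smul_eq_mul, mul_sub,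
          Finset.sum_sub_distrib, ← mul_assoc] at h2
        rw [Finset.sum_insert hj, h1]
        simp only [Function.update_self, sub_mul, Finset.sum_mul, ← mul_assoc]
        linarith

/-- **Strong duality for linear programs**: a lower bound on a linear function over a non-empty
polyhedron is certified by dual multipliers. -/
theorem exists_dual_of_forall_le_dotProduct {m n k : ℕ}
    {A : Matrix (Fin m) (Fin k) ℝ} {q : Fin m → ℝ} {B : Matrix (Fin n) (Fin k) ℝ} {r : Fin n → ℝ}
    (hne : ∃ a : Fin k → ℝ, A *ᵥ a ≤ q ∧ B *ᵥ a = r) {c : Fin k → ℝ} {β : ℝ}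
    (h : ∀ a : Fin k → ℝ, A *ᵥ a ≤ q → B *ᵥ a = r → β ≤ c ⬝ᵥ a) :
    ∃ (ξ : Fin m → ℝ) (η : Fin n → ℝ), ξ ≤ 0 ∧ Aᵀ *ᵥ ξ + Bᵀ *ᵥ η = c ∧
      β ≤ q ⬝ᵥ ξ + r ⬝ᵥ η := by
  classical
  -- Homogenise with an extra coordinate `t ≥ 0`: the constraints become `A a ≤ t q` and `B a = t
  -- r`, the latter as two inequalities, and the bound becomes `β t ≤ c ⬝ᵥ a`.
  let fstL := LinearMap.fst ℝ (Fin k → ℝ) ℝ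
  let sndL := LinearMap.snd ℝ (Fin k → ℝ) ℝ
  let row {l : ℕ} (M : Matrix (Fin l) (Fin k) ℝ) (d : Fin l → ℝ) (i : Fin l) :
      (Fin k → ℝ) × ℝ →ₗ[ℝ] ℝ := LinearMap.proj i ∘ₗ M.mulVecLin ∘ₗ fstL - d i • sndL
  let F : (Fin m ⊕ (Fin n ⊕ Fin n)) ⊕ Unit → (Fin k → ℝ) × ℝ →ₗ[ℝ] ℝ :=
    Sum.elim (Sum.elim (row A q) (Sum.elim (row B r) (fun i => -row B r i))) (fun _ => -sndL)
  let G : (Fin k → ℝ) × ℝ →ₗ[ℝ] ℝ := β • sndL - dotProductBilin ℝ ℝ c ∘ₗ fstL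
  have hrow {l : ℕ} (M : Matrix (Fin l) (Fin k) ℝ) (d : Fin l → ℝ) (i : Fin l) (x) :
      row M d i x = (M *ᵥ x.1) i - d i * x.2 := by simp [row, fstL, sndL]
  have hG (x) : G x = β * x.2 - c ⬝ᵥ x.1 := by simp [G, fstL, sndL, dotProductBilin]
  have hkey : ∀ x, (∀ i ∈ (Finset.univ : Finset ((Fin m ⊕ (Fin n ⊕ Fin n)) ⊕ Unit)),
      F i x ≤ 0) → G x ≤ 0 := by
    rintro ⟨a, t⟩ hx
    have hA (i : Fin m) : (A *ᵥ a) i ≤ q i * t := by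
      have := hx (.inl (.inl i)) (Finset.mem_univ _)
      simp only [F, Sum.elim_inl, hrow] at this
      linarith
    have hB : B *ᵥ a = t • r := by
      ext i
      have h1 := hx (.inl (.inr (.inl i))) (Finset.mem_univ _)
      have h2 := hx (.inl (.inr (.inr i))) (Finset.mem_univ _)
      simp only [F, Sum.elim_inl, Sum.elim_inr, LinearMap.neg_apply, hrow] at h1 h2
      simp only [Pi.smul_apply, smul_eq_mul]
      linarith
    have ht : 0 ≤ t := by
      have := hx (.inr ()) (Finset.mem_univ _)
      simpa [F, sndL] using this
    rw [hG]
    -- For `t = 0`, `a` is a recession direction, along which the objective cannot decrease without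
    -- breaking the bound; for `t > 0`, rescale by `t⁻¹`.
    rcases ht.eq_or_lt with rfl | ht
    · obtain ⟨a₀, hA₀, hB₀⟩ := hne
      by_contra! hc
      simp only [mul_zero, zero_sub, Left.neg_pos_iff] at hc
      have hs (s : ℝ) (hs : 0 ≤ s) : β ≤ c ⬝ᵥ a₀ + s * (c ⬝ᵥ a) := by
        have := h (a₀ + s • a) (fun i => by
          have h1 := hA₀ i
          have h2 := hA i
          simp only [mulVec_add, mulVec_smul, Pi.add_apply, Pi.smul_apply, smul_eq_mul]
          nlinarith) (by simp [mulVec_add, mulVec_smul, hB, hB₀])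
        simpa [dotProduct_add, dotProduct_smul] using this
      have h0 := hs 0 le_rfl
      -- The step length brings the objective to exactly `β - 1`.
      have h1 := hs ((c ⬝ᵥ a₀ - β + 1) / (-(c ⬝ᵥ a))) (div_nonneg (by linarith) (by linarith))
      rw [div_neg, neg_mul, div_mul_cancel₀ _ hc.ne] at h1
      linarith
    · have := h (t⁻¹ • a) (fun i => by
        simp only [mulVec_smul, Pi.smul_apply, smul_eq_mul]
        rw [inv_mul_le_iff₀ ht, mul_comm]
        exact hA i) (by rw [mulVec_smul, hB, smul_smul, inv_mul_cancel₀ ht.ne', one_smul])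
      rw [dotProduct_smul, smul_eq_mul, le_inv_mul_iff₀ ht] at this
      linarith
  obtain ⟨w, hw, hsum⟩ := exists_nonneg_sum_smul_eq_of_forall_nonpos Finset.univ F G hkey
  simp only [hG, Fintype.sum_sum_type, F, Sum.elim_inl, Sum.elim_inr, LinearMap.neg_apply, hrow,
    Finset.univ_unique, Finset.sum_singleton] at hsum
  -- Evaluating the Farkas identity at `(a, 0)` gives the dual equation, and at `(0, 1)` the bound,
  -- with slack the weight of `t ≥ 0`.
  refine ⟨fun i => -w (.inl (.inl i)),
    fun i => w (.inl (.inr (.inr i))) - w (.inl (.inr (.inl i))),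
    fun i => by simpa using hw (.inl (.inl i)) (Finset.mem_univ _), ?_, ?_⟩
  · refine dotProduct_eq _ _ fun a => ?_
    have := hsum (a, 0)
    simp only [mul_zero, sub_zero, zero_sub, sndL, LinearMap.snd_apply, neg_zero, add_zero]
      at this
    rw [add_dotProduct, mulVec_transpose, mulVec_transpose, ← dotProduct_mulVec,
      ← dotProduct_mulVec]
    simp only [dotProduct] at this ⊢
    simp only [neg_mul, sub_mul, mul_neg, Finset.sum_neg_distrib, Finset.sum_sub_distrib]
      at this ⊢
    linarith
  · have := hsum (0, 1)
    have h0 := hw (.inr ()) (Finset.mem_univ _)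
    simp only [mulVec_zero, Pi.zero_apply, mul_one, zero_sub, dotProduct_zero, sub_zero, sndL,
      LinearMap.snd_apply, neg_neg] at this
    change 0 ≤ w (Sum.inr default) at h0
    simp only [dotProduct]
    simp only [mul_neg, mul_sub, Finset.sum_neg_distrib, Finset.sum_sub_distrib] at this ⊢
    simp only [mul_comm (q _), mul_comm (r _)]
    linarith

/-! ### Minimax for probability measures on a compact space. -/

/-- A convex combination of probability measures, together with its integrals. -/
theorem exists_probabilityMeasure_integral_eq_add {Z : Type*} [TopologicalSpace Z]
    [CompactSpace Z] [MeasurableSpace Z] [BorelSpace Z]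
    (γ₁ γ₂ : ProbabilityMeasure Z) {s t : ℝ} (hs : 0 ≤ s) (ht : 0 ≤ t) (hst : s + t = 1) :
    ∃ γ : ProbabilityMeasure Z, ∀ f : Z → ℝ, Continuous f →
      ∫ z, f z ∂(γ : Measure Z)
        = s * ∫ z, f z ∂(γ₁ : Measure Z) + t * ∫ z, f z ∂(γ₂ : Measure Z) := by
  refine ⟨⟨ENNReal.ofReal s • (γ₁ : Measure Z) + ENNReal.ofReal t • (γ₂ : Measure Z), ⟨?_⟩⟩,
    fun f hf => ?_⟩
  · simp [← ENNReal.ofReal_add hs ht, hst]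
  · have hi (γ : ProbabilityMeasure Z) (r : ℝ) :
        Integrable f (ENNReal.ofReal r • (γ : Measure Z)) :=
      (hf.integrable_of_hasCompactSupport
        (HasCompactSupport.of_compactSpace f)).smul_measure ENNReal.ofReal_ne_top
    simp only [ProbabilityMeasure.coe_mk]
    rw [integral_add_measure (hi _ _) (hi _ _), integral_smul_measure, integral_smul_measure,
      ENNReal.toReal_ofReal hs, ENNReal.toReal_ofReal ht, smul_eq_mul, smul_eq_mul]

/-- A **minimax principle** for probability measures on a compact space: if every probability
measure can be answered by a parameter with small integral, then one parameter answers all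
points. -/
theorem exists_forall_lt_of_forall_exists_integral_lt {Z F : Type*} [TopologicalSpace Z]
    [CompactSpace Z] [T2Space Z] [Nonempty Z] [MeasurableSpace Z] [BorelSpace Z]
    [AddCommGroup F] [Module ℝ F] {A : Set F} (hA : Convex ℝ A) (h : F → Z → ℝ)
    (hc : ∀ a, Continuous (h a)) (hconv : ∀ z, ConvexOn ℝ A (fun a => h a z)) {α : ℝ}
    (hlt : ∀ γ : ProbabilityMeasure Z, ∃ a ∈ A, ∫ z, h a z ∂(γ : Measure Z) < α) :
    ∃ a ∈ A, ∀ z, h a z < α := by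
  classical
  have hcont (a : F) :
      Continuous (fun γ : ProbabilityMeasure Z => ∫ z, h a z ∂(γ : Measure Z)) :=
    ProbabilityMeasure.continuous_integral_boundedContinuousFunction
      (BoundedContinuousFunction.mkOfCompact ⟨h a, hc a⟩)
  -- Weak compactness of the space of probability measures leaves finitely many parameters to
  -- consider.
  obtain ⟨s, hs⟩ := isCompact_univ.elim_finite_subcover
    (fun a : A => {γ : ProbabilityMeasure Z | ∫ z, h a z ∂(γ : Measure Z) < α})
    (fun a => isOpen_lt (hcont a) continuous_const)
    (fun γ _ => by
      obtain ⟨a, ha, hγ⟩ := hlt γ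
      exact Set.mem_iUnion.2 ⟨⟨a, ha⟩, hγ⟩)
  let I : Set (s → ℝ) :=
    Set.range fun (γ : ProbabilityMeasure Z) (a : s) => ∫ z, h (a : A) z ∂(γ : Measure Z)
  have hIc : IsCompact I := isCompact_range (continuous_pi fun a => hcont _)
  have hIconv : Convex ℝ I := by
    rintro _ ⟨γ₁, rfl⟩ _ ⟨γ₂, rfl⟩ p q hp hq hpq
    obtain ⟨γ, hγ⟩ := exists_probabilityMeasure_integral_eq_add γ₁ γ₂ hp hq hpq
    exact ⟨γ, funext fun a => by simp [hγ _ (hc _)]⟩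
  let T : Set (s → ℝ) := Set.Ici fun _ => α
  have hdisj : Disjoint I T := by
    rw [Set.disjoint_left]
    rintro _ ⟨γ, rfl⟩ hT
    obtain ⟨a, has, hγ⟩ := Set.mem_iUnion₂.1 (hs (Set.mem_univ γ))
    exact absurd (hT ⟨a, has⟩) (not_le.2 hγ)
  -- The compact convex set of integral vectors misses the orthant above `α`; the separating
  -- functional supplies the weights of a mixed parameter.
  obtain ⟨f, u, v, hfu, huv, hfv⟩ :=
    geometric_hahn_banach_compact_closed hIconv hIc (convex_Ici _) isClosed_Ici hdisj
  let w : s → ℝ := fun a => f (Pi.single a 1)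
  have hf (y : s → ℝ) : f y = ∑ a, w a * y a := by
    conv_lhs => rw [pi_eq_sum_univ' y, map_sum]
    refine Finset.sum_congr rfl fun a _ => ?_
    rw [map_smul, smul_eq_mul, mul_comm]
  have hα : v < (∑ a, w a) * α := by
    have := hfv (fun _ => α) Set.self_mem_Ici
    rwa [hf, ← Finset.sum_mul] at this
  -- A negative weight would make `f` unbounded below on the orthant.
  have hw (a : s) : 0 ≤ w a := by
    by_contra! hneg
    have hr (r : ℝ) (hr : 0 ≤ r) : v < (∑ a, w a) * α + r * w a := by
      have := hfv ((fun _ => α) + r • Pi.single a 1) (fun b => by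
        have : (0 : ℝ) ≤ r * Pi.single (M := fun _ => ℝ) a 1 b :=
          mul_nonneg hr (by rw [Pi.single_apply]; split_ifs <;> norm_num)
        simpa using this)
      rwa [map_add, map_smul, hf, ← Finset.sum_mul] at this
    have := hr (((∑ a, w a) * α - v) / (-w a)) (div_nonneg (by linarith) (by linarith))
    rw [div_neg, neg_mul, div_mul_cancel₀ _ hneg.ne] at this
    linarith
  -- Dirac measures turn the bound on integrals into a pointwise one.
  have hz (z : Z) : ∑ a, w a * h (a : A) z < u := by
    have := hfu _ ⟨diracProba z, rfl⟩
    rw [hf] at this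
    simpa [diracProba] using this
  obtain ⟨z₀⟩ := ‹Nonempty Z›
  -- If all weights vanished, the separation would read `0 < u < v < 0`; a point of `Z` is needed
  -- for the first inequality.
  have hσ : 0 < ∑ a, w a := by
    refine (Finset.sum_nonneg fun a _ => hw a).lt_of_ne fun h0 => ?_
    have hw0 (a : s) : w a = 0 :=
      (Finset.sum_eq_zero_iff_of_nonneg fun a _ => hw a).1 h0.symm a (Finset.mem_univ a)
    have := hz z₀
    simp only [hw0, zero_mul, Finset.sum_const_zero] at this hα
    linarith
  have hw1 : ∑ a, w a / ∑ b, w b = 1 := by rw [← Finset.sum_div, div_self hσ.ne']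
  refine ⟨∑ a, (w a / ∑ b, w b) • ((a : A) : F),
    hA.sum_mem (fun a _ => div_nonneg (hw a) hσ.le) hw1 (fun a _ => (a : A).2), fun z => ?_⟩
  have hle := (hconv z).map_sum_le (t := Finset.univ) (w := fun a : s => w a / ∑ b, w b)
    (p := fun a => ((a : A) : F)) (fun a _ => div_nonneg (hw a) hσ.le) hw1
    (fun a _ => (a : A).2)
  refine hle.trans_lt ?_
  have : ∑ a, (w a / ∑ b, w b) • h (a : A) z = (∑ a, w a * h (a : A) z) / ∑ b, w b := by
    rw [Finset.sum_div]
    exact Finset.sum_congr rfl fun a _ => by rw [smul_eq_mul]; ring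
  rw [this, div_lt_iff₀ hσ]
  linarith [hz z]

/-- A bound in `EReal` that is tested on real upper bounds only. -/
theorem EReal.le_of_forall_real_gt {x y : EReal} (h : ∀ r : ℝ, y < r → x ≤ r) : x ≤ y := by
  refine le_of_forall_gt_imp_ge_of_dense fun z hz => ?_
  obtain ⟨r, hyr, hrz⟩ := EReal.lt_iff_exists_real_btwn.1 hz
  exact (h r hyr).trans hrz.le

/-! ### Regularity, integrals and moments for the two-stage problem. -/

namespace DROProblem

variable {N K₁ K₂ nin neq : ℕ} (P : DROProblem N K₁ K₂ nin neq)

instance compactSpace_X (i : Fin N) : CompactSpace (P.X i) :=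
  isCompact_iff_compactSpace.mp (P.X_compact i)

instance compactSpace_S₂ : CompactSpace P.S₂ := by
  obtain ⟨⟨r, A, d, hS⟩, hb⟩ := P.S₂_polytope
  have hc : IsClosed P.S₂ := by
    rw [hS]
    exact isClosed_le (by fun_prop) continuous_const
  exact isCompact_iff_compactSpace.mp (Metric.isCompact_of_isClosed_isBounded hc hb)

instance nonempty_X (i : Fin N) : Nonempty (P.X i) := (P.X_nonempty i).to_subtype

instance nonempty_S₂ : Nonempty P.S₂ := P.S₂_nonempty.to_subtype

@[fun_prop]
theorem continuous_vec : Continuous P.vec := by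
  unfold vec
  fun_prop

theorem continuous_uncurry_Qaug (a : Fin K₁ → ℝ) :
    Continuous (fun p : (∀ i, P.X i) × P.S₂ => P.Qaug a p.1 p.2) := by
  unfold Qaug
  refine Continuous.dotProduct ?_ (by fun_prop)
  exact (continuous_const.add
    (continuous_const.matrix_mulVec (P.continuous_vec.comp continuous_fst))).add continuous_const

theorem continuous_cost :
    Continuous (fun p : (∀ i, P.X i) × P.S₂ =>
      (P.W *ᵥ P.vec p.1 + P.b) ⬝ᵥ (p.2 : Fin K₂ → ℝ)) := by
  refine Continuous.dotProduct ?_ (by fun_prop)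
  exact (continuous_const.matrix_mulVec (P.continuous_vec.comp continuous_fst)).add
    continuous_const

theorem continuous_Q (a : Fin K₁ → ℝ) : Continuous (P.Q a) := by
  have := (isCompact_univ (X := P.S₂)).continuous_sSup (f := fun x l => P.Qaug a x l)
    (P.continuous_uncurry_Qaug a)
  refine this.congr fun x => ?_
  rw [Q, Set.image_univ, sSup_range]

theorem integrable_of_continuous {Z : Type*} [TopologicalSpace Z] [CompactSpace Z]
    [MeasurableSpace Z] [OpensMeasurableSpace Z] (γ : ProbabilityMeasure Z) {f : Z → ℝ}
    (hf : Continuous f) : Integrable f (γ : Measure Z) :=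
  hf.integrable_of_hasCompactSupport (HasCompactSupport.of_compactSpace f)

theorem Qaug_eq (a : Fin K₁ → ℝ) (x : ∀ i, P.X i) (l : P.S₂) :
    P.Qaug a x l = (P.V *ᵥ a) ⬝ᵥ (l : Fin K₂ → ℝ)
      + (P.W *ᵥ P.vec x + P.b) ⬝ᵥ (l : Fin K₂ → ℝ) := by
  rw [Qaug, add_assoc, add_dotProduct]

theorem transpose_V_mulVec_dotProduct (a : Fin K₁ → ℝ) (l : Fin K₂ → ℝ) :
    (P.Vᵀ *ᵥ l) ⬝ᵥ a = (P.V *ᵥ a) ⬝ᵥ l := by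
  rw [mulVec_transpose, ← dotProduct_mulVec, dotProduct_comm]

/-- The mean of the second-stage dual variable. -/
noncomputable def meanDual (γ : ProbabilityMeasure ((∀ i, P.X i) × P.S₂)) : Fin K₂ → ℝ :=
  fun k => ∫ p, (p.2 : Fin K₂ → ℝ) k ∂(γ : Measure ((∀ i, P.X i) × P.S₂))

theorem integral_Qaug (a : Fin K₁ → ℝ) (γ : ProbabilityMeasure ((∀ i, P.X i) × P.S₂)) :
    ∫ p, P.Qaug a p.1 p.2 ∂(γ : Measure ((∀ i, P.X i) × P.S₂))
      = (P.Vᵀ *ᵥ P.meanDual γ) ⬝ᵥ a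
        + ∫ p, (P.W *ᵥ P.vec p.1 + P.b) ⬝ᵥ (p.2 : Fin K₂ → ℝ)
            ∂(γ : Measure ((∀ i, P.X i) × P.S₂)) := by
  simp only [Qaug_eq]
  rw [integral_add (integrable_of_continuous γ (by
      exact Continuous.dotProduct continuous_const (by fun_prop)))
    (integrable_of_continuous γ P.continuous_cost), transpose_V_mulVec_dotProduct]
  congr 1
  simp only [dotProduct, meanDual]
  have hk (k : Fin K₂) :
      Integrable (fun p : (∀ i, P.X i) × P.S₂ => (P.V *ᵥ a) k * (p.2 : Fin K₂ → ℝ) k)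
        (γ : Measure ((∀ i, P.X i) × P.S₂)) :=
    integrable_of_continuous γ
      (continuous_const.mul ((continuous_apply k).comp
        (continuous_subtype_val.comp continuous_snd)))
  rw [integral_finsetSum _ fun k _ => hk k]
  simp only [integral_const_mul]

variable {m : Fin N → ℕ} {g : ∀ i, Fin (m i) → P.X i → ℝ}

theorem continuous_gvec (hg : ∀ i j, Continuous (g i j)) : Continuous (P.gvec g) :=
  continuous_pi fun k => (hg k.1 k.2).comp (continuous_apply k.1)

theorem integral_gvec_dotProduct (hg : ∀ i j, Continuous (g i j))
    (γ : ProbabilityMeasure ((∀ i, P.X i) × P.S₂)) (y : ((i : Fin N) × Fin (m i)) → ℝ) :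
    ∫ p, P.gvec g p.1 ⬝ᵥ y ∂(γ : Measure ((∀ i, P.X i) × P.S₂))
      = (fun k => ∫ p, P.gvec g p.1 k ∂(γ : Measure ((∀ i, P.X i) × P.S₂))) ⬝ᵥ y := by
  have h := P.continuous_gvec hg
  simp only [dotProduct]
  have hk (k : (i : Fin N) × Fin (m i)) :
      Integrable (fun p : (∀ i, P.X i) × P.S₂ => P.gvec g p.1 k * y k)
        (γ : Measure ((∀ i, P.X i) × P.S₂)) :=
    integrable_of_continuous γ
      (((continuous_apply k).comp (h.comp continuous_fst)).mul continuous_const)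
  rw [integral_finsetSum _ fun k _ => hk k]
  simp only [integral_mul_const]

/-- The relaxed ambiguity set is cut out by finitely many moment equations. -/
theorem mem_augMomentCouplings_iff (hg : ∀ i j, Continuous (g i j))
    (γ : ProbabilityMeasure ((∀ i, P.X i) × P.S₂)) :
    γ ∈ augMomentCouplings P.S₂ (fun i => Set.range (g i)) P.μ ↔
      (fun k => ∫ p, P.gvec g p.1 k ∂(γ : Measure ((∀ i, P.X i) × P.S₂))) = P.vvec g := by
  have hmeas (i : Fin N) : Measurable (fun p : (∀ i, P.X i) × P.S₂ => p.1 i) := by fun_prop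
  have hmap (i : Fin N) (j : Fin (m i)) :
      ∫ x, g i j x ∂((γ : Measure ((∀ i, P.X i) × P.S₂)).map (fun p => p.1 i))
        = ∫ p, g i j (p.1 i) ∂(γ : Measure ((∀ i, P.X i) × P.S₂)) :=
    integral_map (hmeas i).aemeasurable (hg i j).aestronglyMeasurable
  constructor
  · rintro ⟨ν, hν, hγ⟩
    ext ⟨i, j⟩
    have := (hν i).2 (g i j) ⟨j, rfl⟩
    rw [← hγ i, hmap] at this
    exact this
  · intro h
    -- The marginals of `γ` itself serve as the `ν i`.
    refine ⟨fun i => γ.map (hmeas i).aemeasurable, fun i => ⟨?_, ?_⟩, fun i => rfl⟩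
    · rintro _ ⟨j, rfl⟩
      exact integrable_of_continuous _ (hg i j)
    · rintro _ ⟨j, rfl⟩
      exact (hmap i j).trans (congrFun h ⟨i, j⟩)

/-- A uniform bound over all couplings in the relaxed ambiguity set, by decisions that may depend
on the coupling, bounds the optimal value of (LSIP). -/
theorem lsipValue_le_of_forall_exists_lt (hg : ∀ i j, Continuous (g i j))
    {A : Set (Fin K₁ → ℝ)} (hA : Convex ℝ A) (hne : A.Nonempty) (hAS : A ⊆ P.S₁) {α : ℝ}
    (h : ∀ γ ∈ augMomentCouplings P.S₂ (fun i => Set.range (g i)) P.μ, ∃ a ∈ A,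
      P.c₁ ⬝ᵥ a + ∫ p, P.Qaug a p.1 p.2 ∂(γ : Measure ((∀ i, P.X i) × P.S₂)) < α) :
    P.lsipValue g ≤ α := by
  classical
  -- The Lagrangian of the moment constraints. Its integral is the cost of `a` plus the moment
  -- defect of `γ` paired with `y`.
  let f : (Fin K₁ → ℝ) × (((i : Fin N) × Fin (m i)) → ℝ) → (∀ i, P.X i) × P.S₂ → ℝ :=
    fun t p => P.c₁ ⬝ᵥ t.1 + P.vvec g ⬝ᵥ t.2 + P.Qaug t.1 p.1 p.2 - P.gvec g p.1 ⬝ᵥ t.2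
  have hcg (y : ((i : Fin N) × Fin (m i)) → ℝ) :
      Continuous (fun p : (∀ i, P.X i) × P.S₂ => P.gvec g p.1 ⬝ᵥ y) :=
    ((P.continuous_gvec hg).comp continuous_fst).dotProduct continuous_const
  have hint (a) (y) (γ : ProbabilityMeasure ((∀ i, P.X i) × P.S₂)) :
      ∫ p, f (a, y) p ∂(γ : Measure ((∀ i, P.X i) × P.S₂))
        = P.c₁ ⬝ᵥ a + ∫ p, P.Qaug a p.1 p.2 ∂(γ : Measure ((∀ i, P.X i) × P.S₂))
          + (P.vvec g
            - fun k => ∫ p, P.gvec g p.1 k ∂(γ : Measure ((∀ i, P.X i) × P.S₂))) ⬝ᵥ y := by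
    have hQ := integrable_of_continuous γ (P.continuous_uncurry_Qaug a)
    simp only [f]
    rw [integral_sub (f := fun p : (∀ i, P.X i) × P.S₂ => P.c₁ ⬝ᵥ a + P.vvec g ⬝ᵥ y
        + P.Qaug a p.1 p.2) ((integrable_const _).add hQ) (integrable_of_continuous γ (hcg y)),
      integral_add (integrable_const _) hQ, integral_gvec_dotProduct P hg, sub_dotProduct]
    simp only [integral_const, probReal_univ, one_smul]
    ring
  obtain ⟨⟨a, y⟩, ha, hlt⟩ := exists_forall_lt_of_forall_exists_integral_lt
    (A := A ×ˢ Set.univ) (hA.prod convex_univ) f (α := α)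
    (fun t => (continuous_const.add (P.continuous_uncurry_Qaug t.1)).sub (hcg t.2))
    (fun p => ⟨hA.prod convex_univ, fun t _ t' _ r s _ _ hrs => le_of_eq (by
      simp only [f, Qaug_eq, Prod.fst_add, Prod.snd_add, Prod.smul_fst, Prod.smul_snd,
        dotProduct_add, dotProduct_smul, mulVec_add, mulVec_smul, add_dotProduct, smul_dotProduct,
        smul_eq_mul]
      linear_combination (-((P.W *ᵥ P.vec p.1) ⬝ᵥ (p.2 : Fin K₂ → ℝ))
        - P.b ⬝ᵥ (p.2 : Fin K₂ → ℝ)) * hrs)⟩)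
    (fun γ => by
      by_cases hγ : γ ∈ augMomentCouplings P.S₂ (fun i => Set.range (g i)) P.μ
      · obtain ⟨a, ha, hlt⟩ := h γ hγ
        refine ⟨(a, 0), ⟨ha, trivial⟩, ?_⟩
        simpa [hint] using hlt
      -- With a nonzero moment defect `d`, a multiple of `d` as multiplier makes the integral equal
      -- to `α - 1`, whatever `a` is.
      · rw [mem_augMomentCouplings_iff P hg] at hγ
        obtain ⟨a, ha⟩ := hne
        set d := P.vvec g
          - fun k => ∫ p, P.gvec g p.1 k ∂(γ : Measure ((∀ i, P.X i) × P.S₂)) with hd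
        have hd0 : d ⬝ᵥ d ≠ 0 := by
          rw [Ne, dotProduct_self_eq_zero, hd, sub_eq_zero]
          exact fun h => hγ h.symm
        refine ⟨(a, ((α - 1 - (P.c₁ ⬝ᵥ a
          + ∫ p, P.Qaug a p.1 p.2 ∂(γ : Measure ((∀ i, P.X i) × P.S₂)))) / (d ⬝ᵥ d)) • d),
          ⟨ha, trivial⟩, ?_⟩
        rw [hint, ← hd, dotProduct_smul, smul_eq_mul, div_mul_cancel₀ _ hd0]
        linarith)
  -- This `y₀` makes the objective exactly `α`; the pointwise bound `f < α` is then the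
  -- semi-infinite constraint.
  refine (iInf₂_le (a, α - P.c₁ ⬝ᵥ a - P.vvec g ⬝ᵥ y, y) ⟨?_, hAS ha.1⟩).trans
    (le_of_eq ?_)
  · congr 1
    ring
  · intro x l
    have := hlt (x, l)
    simp only [f, Qaug_eq] at this
    simp only [transpose_V_mulVec_dotProduct]
    linarith

/-! ### The inequalities between the optimal values. -/

theorem convex_S₁ : Convex ℝ P.S₁ := by
  rintro a ⟨ha, ha'⟩ b ⟨hb, hb'⟩ r s hr hs hrs
  refine ⟨fun i => ?_, ?_⟩
  · have h1 := mul_le_mul_of_nonneg_left (ha i) hr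
    have h2 := mul_le_mul_of_nonneg_left (hb i) hs
    simp only [mulVec_add, mulVec_smul, Pi.add_apply, Pi.smul_apply, smul_eq_mul]
    linear_combination h1 + h2 + P.qin i * hrs
  · rw [mulVec_add, mulVec_smul, mulVec_smul, ha', hb', ← add_smul, hrs, one_smul]

theorem lsipValue_le_φDROsur (hg : ∀ i j, Continuous (g i j)) :
    P.lsipValue g ≤ P.φDROsur (fun i => Set.range (g i)) := by
  refine le_iInf₂ fun a ha => EReal.le_of_forall_real_gt fun α hα => ?_
  refine P.lsipValue_le_of_forall_exists_lt hg (convex_singleton a) (Set.singleton_nonempty a)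
    (Set.singleton_subset_iff.2 ha) fun γ hγ => ⟨a, rfl, ?_⟩
  rw [← EReal.coe_lt_coe_iff, EReal.coe_add]
  refine lt_of_le_of_lt (add_le_add le_rfl ?_) hα
  exact le_iSup₂ (f := fun (γ : ProbabilityMeasure ((∀ i, P.X i) × P.S₂))
    (_ : γ ∈ augMomentCouplings P.S₂ (fun i => Set.range (g i)) P.μ) =>
      ((∫ p, P.Qaug a p.1 p.2 ∂(γ : Measure ((∀ i, P.X i) × P.S₂)) : ℝ) : EReal)) γ hγ

theorem Qaug_le_of_mem_lsipFeasible {t} (ht : t ∈ P.lsipFeasible g) (x : ∀ i, P.X i)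
    (l : P.S₂) : P.Qaug t.1 x l ≤ t.2.1 + P.gvec g x ⬝ᵥ t.2.2 := by
  have := ht.1 x l
  rw [transpose_V_mulVec_dotProduct] at this
  rw [Qaug_eq]
  linarith

theorem φDROsur_le_lsipValue (hg : ∀ i j, Continuous (g i j)) :
    P.φDROsur (fun i => Set.range (g i)) ≤ P.lsipValue g := by
  refine le_iInf₂ fun t ht => (iInf₂_le t.1 ht.2).trans ?_
  rw [φsur, add_assoc, EReal.coe_add]
  refine add_le_add le_rfl (iSup₂_le fun γ hγ => EReal.coe_le_coe_iff.2 ?_)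
  have hγ' := (P.mem_augMomentCouplings_iff hg γ).1 hγ
  have hcg : Continuous (fun p : (∀ i, P.X i) × P.S₂ => P.gvec g p.1 ⬝ᵥ t.2.2) :=
    ((P.continuous_gvec hg).comp continuous_fst).dotProduct continuous_const
  have := integral_mono (integrable_of_continuous γ (P.continuous_uncurry_Qaug t.1))
    ((integrable_const t.2.1).add (integrable_of_continuous γ hcg))
    (fun p => P.Qaug_le_of_mem_lsipFeasible ht p.1 p.2)
  refine this.trans (le_of_eq ?_)
  simp only [Pi.add_apply]
  rw [integral_add (integrable_const _) (integrable_of_continuous γ hcg),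
    integral_gvec_dotProduct P hg, hγ']
  simp

/-- The constraint, maximised over `l`, bounds `Q` pointwise and is integrated against an ordinary
coupling. Working with `Q` directly avoids selecting a maximiser `l` measurably in `x`. -/
theorem φDRO_le_lsipValue (hg : ∀ i j, Continuous (g i j)) : P.φDRO ≤ P.lsipValue g := by
  refine le_iInf₂ fun t ht => (iInf₂_le t.1 ht.2).trans ?_
  rw [φ, add_assoc, EReal.coe_add]
  refine add_le_add le_rfl (iSup₂_le fun γ hγ => EReal.coe_le_coe_iff.2 ?_)
  have hgi (k : (i : Fin N) × Fin (m i)) :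
      Integrable (fun x => P.gvec g x k * t.2.2 k) (γ : Measure (∀ i, P.X i)) :=
    integrable_of_continuous γ
      (((continuous_apply k).comp (P.continuous_gvec hg)).mul continuous_const)
  have hcg : Continuous (fun x => P.gvec g x ⬝ᵥ t.2.2) :=
    (P.continuous_gvec hg).dotProduct continuous_const
  have := integral_mono (integrable_of_continuous γ (P.continuous_Q t.1))
    ((integrable_const t.2.1).add (integrable_of_continuous γ hcg))
    (fun x => ciSup_le fun l => P.Qaug_le_of_mem_lsipFeasible ht x l)
  refine this.trans (le_of_eq ?_)
  simp only [Pi.add_apply]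
  rw [integral_add (integrable_const _) (integrable_of_continuous γ hcg)]
  simp only [dotProduct, integral_const, probReal_univ, one_smul]
  rw [integral_finsetSum _ fun k _ => hgi k]
  congr 1
  refine Finset.sum_congr rfl fun k _ => ?_
  rw [integral_mul_const, vvec, ← hγ k.1,
    integral_map (measurable_pi_apply k.1).aemeasurable (hg k.1 k.2).aestronglyMeasurable]
  rfl

theorem dualValue_le_φDROsur :
    P.dualValue g ≤ P.φDROsur (fun i => Set.range (g i)) := by
  refine iSup₂_le fun t ht => le_iInf₂ fun a ha => ?_
  obtain ⟨ξ, η, γ⟩ := t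
  obtain ⟨hξ, hγ, hc⟩ := ht
  obtain ⟨ha, ha'⟩ := ha
  have hsup := le_iSup₂ (f := fun (γ : ProbabilityMeasure ((∀ i, P.X i) × P.S₂))
    (_ : γ ∈ augMomentCouplings P.S₂ (fun i => Set.range (g i)) P.μ) =>
      ((∫ p, P.Qaug a p.1 p.2 ∂(γ : Measure ((∀ i, P.X i) × P.S₂)) : ℝ) : EReal)) γ hγ
  refine le_trans ?_ (add_le_add le_rfl hsup)
  rw [← EReal.coe_add, EReal.coe_le_coe_iff, integral_Qaug]
  change _ - P.Vᵀ *ᵥ P.meanDual γ = _ at hc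
  have hca := congrArg (· ⬝ᵥ a) hc
  simp only [sub_dotProduct, add_dotProduct] at hca
  rw [mulVec_transpose P.Lin, mulVec_transpose P.Leq, ← dotProduct_mulVec, ← dotProduct_mulVec,
    ha'] at hca
  -- Since `ξ ≤ 0`, multiplying `Lin a ≤ qin` by it reverses the inequality.
  have hq : P.qin ⬝ᵥ ξ ≤ ξ ⬝ᵥ (P.Lin *ᵥ a) := by
    simp only [dotProduct]
    refine Finset.sum_le_sum fun i _ => ?_
    rw [mul_comm]
    exact mul_le_mul_of_nonpos_left (ha i) (hξ i)
  rw [dotProduct_comm η] at hca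
  dsimp only at hca ⊢
  linarith

/-- Here `A` is all of `S₁`. If no `a` answered some `γ`, linear programming duality at this `γ`
would yield a dual feasible point of value at least `α`. -/
theorem lsipValue_le_dualValue (hg : ∀ i j, Continuous (g i j)) :
    P.lsipValue g ≤ P.dualValue g := by
  refine EReal.le_of_forall_real_gt fun α hα => ?_
  refine P.lsipValue_le_of_forall_exists_lt hg P.convex_S₁ P.feasible subset_rfl fun γ hγ => ?_
  by_contra! hc
  set τ := ∫ p, (P.W *ᵥ P.vec p.1 + P.b) ⬝ᵥ (p.2 : Fin K₂ → ℝ)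
    ∂(γ : Measure ((∀ i, P.X i) × P.S₂)) with hτ
  -- For fixed `γ` the objective is affine in `a`: its slope is `c₁ + Vᵀ` applied to the mean of
  -- `l`, its constant term `τ`.
  obtain ⟨ξ, η, hξ, hcξ, hβ⟩ := exists_dual_of_forall_le_dotProduct P.feasible
    (c := P.c₁ + P.Vᵀ *ᵥ P.meanDual γ) (β := α - τ) (fun a ha ha' => by
      have := hc a ⟨ha, ha'⟩
      rw [integral_Qaug, ← hτ] at this
      rw [add_dotProduct]
      linarith)
  have hmem : (ξ, η, γ) ∈ P.dualFeasible g := ⟨hξ, hγ, sub_eq_iff_eq_add.2 hcξ⟩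
  have hle := (le_iSup₂ (f := fun t (_ : t ∈ P.dualFeasible g) =>
    ((P.qin ⬝ᵥ t.1 + P.qeq ⬝ᵥ t.2.1
      + ∫ p, (P.W *ᵥ P.vec p.1 + P.b) ⬝ᵥ (p.2 : Fin K₂ → ℝ)
          ∂(t.2.2 : Measure ((∀ i, P.X i) × P.S₂)) : ℝ) : EReal)) _ hmem).trans_lt hα
  rw [EReal.coe_lt_coe_iff] at hle
  dsimp only at hle
  linarith

end DROProblem

theorem theorem2 {N K₁ K₂ nin neq : ℕ} (P : DROProblem N K₁ K₂ nin neq) (m : Fin N → ℕ)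
    (g : ∀ i, Fin (m i) → P.X i → ℝ) (hg : ∀ i j, Continuous (g i j)) :
    P.lsipValue g = P.φDROsur (fun i => Set.range (g i)) ∧
      P.lsipValue g = P.dualValue g ∧
      P.φDRO ≤ P.lsipValue g :=
  ⟨le_antisymm (P.lsipValue_le_φDROsur hg) (P.φDROsur_le_lsipValue hg),
    le_antisymm (P.lsipValue_le_dualValue hg)
      (P.dualValue_le_φDROsur.trans (P.φDROsur_le_lsipValue hg)),
    P.φDRO_le_lsipValue hg⟩
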